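/- Let $\Sigma$ be a finite alphabet. The Parikh map $\Psi\colon\Sigma^*\to\mathbb N^\Sigma$ sends a word $w$ to $\Psi(w)=(|w|_a)_{a\in\Sigma}$, where $|w|_a$ is the number of occurrences of $a$ in $w$. A language $L\subseteq\Sigma^*$ is permutation-invariant if for all $u,v\in\Sigma^*$ with $\Psi(u)=\Psi(v)$ we have $u\in L\iff v\in L$. For $d\in\mathbb N$, a $d$-dimensional simplified multicounter machine is a tuple $M=(Q,\Sigma,q_0,\delta,u,F)$ with a finite set $Q$ of states, an initial state $q_0\in Q$, a transition function $\delta\colon Q\times\Sigma\times\{0,1\}^d\to Q$, a counter update function $u\colon\Sigma\to\{+1,-1,\cdot 0,\cdot 1\}^d$ and a set $F\subseteq Q\times\{0,1\}^d$. For $x\in\mathbb Z^d$ let $\operatorname{mask}(x)\in\{0,1\}^d$ be the vector with $\operatorname{mask}(x)_i=0$ if and only if $x_i=0$. The vector $u(a)$ acts on $\mathbb Z^d$ componentwise: it increments, decrements, resets to $0$, or leaves unchanged the $i$-th component according to whether $u(a)_i$ is $+1$, $-1$, $\cdot 0$ or $\cdot 1$. Reading a letter $a$ in the configuration $(p,x)\in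 Q\times\mathbb Z^d$, the machine moves to the configuration $(\delta(p,a,\operatorname{mask}(x)),\,u(a)(x))$. A word $w$ is accepted by $M$ if reading $w$ from the configuration $(q_0,0)$ leads to a configuration $(q,x)$ with $(q,\operatorname{mask}(x))\in F$, and the language accepted by $M$ is the set of all accepted words. Statement: if $L\subseteq\Sigma^*$ is permutation-invariant and is the language accepted by some simplified multicounter machine, then its Parikh image $\Psi(L)=\{\Psi(w)\mid w\in L\}\subseteq\mathbb N^\Sigma$ is semilinear, that is, a finite union of sets of the form $\{v_0+n_1v_1+\dots+n_kv_k\mid n_1,\dots,n_k\in\mathbb N\}$ with $k\in\mathbb N$ and $v_0,\dots,v_k\in\mathbb N^\Sigma$. -/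

import Mathlib

/-- The Parikh map: `parikh w a` is the number of occurrences of the letter `a` in the word `w`. -/
def parikh {α : Type*} [DecidableEq α] (w : List α) : α → ℕ :=
  fun a => w.count a

/-- A language is permutation-invariant if membership of a word depends only on its
Parikh vector. -/
def PermutationInvariant {α : Type*} [DecidableEq α] (L : Language α) : Prop :=
  ∀ u v : List α, parikh u = parikh v → (u ∈ L ↔ v ∈ L)

/-- The counter operations: increment (`+1`), decrement (`-1`), reset (`·0`) and
no-operation (`·1`). -/
inductive CounterOp : Type
  | inc : CounterOp
  | dec : CounterOp
  | reset : CounterOp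
  | nop : CounterOp

/-- The function on integers induced by a counter operation. -/
def CounterOp.apply : CounterOp → ℤ → ℤ
  | CounterOp.inc, x => x + 1
  | CounterOp.dec, x => x - 1
  | CounterOp.reset, _ => 0
  | CounterOp.nop, x => x

/-- The masking function `ℤ^d → {0,1}^d` (with `false` for `0` and `true` for `1`): a component
of the mask is `0` exactly if the corresponding component of the vector is `0`. -/
def counterMask {d : ℕ} (x : Fin d → ℤ) : Fin d → Bool :=
  fun i => decide (x i ≠ 0)

/-- A `d`-dimensional simplified multicounter machine with states `Q` and input alphabet `α`.
The update of the counters depends on the input letter only. -/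
structure SimplifiedMulticounterMachine (Q α : Type*) (d : ℕ) where
  /-- the initial state -/
  start : Q
  /-- the transition function -/
  trans : Q → α → (Fin d → Bool) → Q
  /-- the counter update function -/
  update : α → Fin d → CounterOp
  /-- the masked accepting configurations -/
  accept : Set (Q × (Fin d → Bool))

namespace SimplifiedMulticounterMachine

/-- One step of the machine: reading `a` leads from configuration `c` to configuration `c'`. -/
def Step {Q α : Type*} {d : ℕ} (M : SimplifiedMulticounterMachine Q α d) (a : α)
    (c c' : Q × (Fin d → ℤ)) : Prop :=
  c'.1 = M.trans c.1 a (counterMask c.2) ∧ ∀ i, c'.2 i = (M.update a i).apply (c.2 i)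

/-- `M.Run w c c'`: reading the word `w`, letter by letter from the left, leads from
configuration `c` to configuration `c'`. -/
inductive Run {Q α : Type*} {d : ℕ} (M : SimplifiedMulticounterMachine Q α d) :
    List α → Q × (Fin d → ℤ) → Q × (Fin d → ℤ) → Prop
  | nil (c : Q × (Fin d → ℤ)) : Run M [] c c
  | cons {a : α} {w : List α} {c c' c'' : Q × (Fin d → ℤ)}
      (hstep : M.Step a c c') (hrun : Run M w c' c'') : Run M (a :: w) c c''

/-- The language of the words accepted by the machine, starting with all counters at zero. -/
def acceptedLanguage {Q α : Type*} {d : ℕ} (M : SimplifiedMulticounterMachine Q α d) :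
    Language α :=
  {w | ∃ (q : Q) (x : Fin d → ℤ),
    M.Run w (M.start, fun _ => 0) (q, x) ∧ (q, counterMask x) ∈ M.accept}

end SimplifiedMulticounterMachine


/-!
By permutation invariance, only the sorted words `a₁ ^ n₁ ⋯ a_k ^ n_k` matter. While a single letter
is read repeatedly, every counter becomes or ceases to be zero at most twice, so that the run
splits into at most `2 * d + 1` phases in which the mask is constant. During such a phase the state
moves along the orbit of a self-map of a finite set, which is ultimately periodic, and each counter
is translated at unit speed, constant, or reset. Hence the relation between the number of letters
read and the configurations before and after is semilinear, and semilinear sets are closed under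
composition of relations because they are closed under Boolean operations, images and preimages.
-/
section Semilinear

variable {M N X Y Z : Type*} [AddCommMonoid M] [AddCommMonoid N] [AddCommMonoid X]
  [AddCommMonoid Y] [AddCommMonoid Z]

theorem isSemilinearSet_setOfPred_exists {s : Set (M × N)} (hs : IsSemilinearSet s) :
    IsSemilinearSet {x | ∃ y, (x, y) ∈ s} := by
  convert! hs.image (AddMonoidHom.fst M N)
  ext x
  simp

theorem isSemilinearSet_setOfPred_lt [AddMonoid.FG M] (f g : M →+ ℕ) :
    IsSemilinearSet {x | f x < g x} := by
  have hdiff := isSemilinearSet_setOfPred_eq 1 0 (f.coprod (.id ℕ)) (g.comp (.fst M ℕ))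
  convert! isSemilinearSet_setOfPred_exists hdiff using 3 with x
  simp [Nat.lt_iff_add_one_le, le_iff_exists_add, add_comm, add_left_comm, eq_comm]

theorem isSemilinearSet_setOfPred_forall_lt [AddMonoid.FG M] {s : Set (M × ℕ)}
    (hs : IsSemilinearSet s) : IsSemilinearSet {p : M × ℕ | ∀ i < p.2, (p.1, i) ∈ s} := by
  have hlt : IsSemilinearSet {p : (M × ℕ) × ℕ | p.2 < p.1.2} :=
    isSemilinearSet_setOfPred_lt (.snd (M × ℕ) ℕ) ((AddMonoidHom.snd M ℕ).comp (.fst (M × ℕ) ℕ))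
  have hnot : IsSemilinearSet {p : (M × ℕ) × ℕ | (p.1.1, p.2) ∉ s} :=
    hs.compl.preimage ((AddMonoidHom.fst M ℕ).prodMap (.id ℕ))
  convert! (isSemilinearSet_setOfPred_exists (hlt.inter hnot)).compl using 1
  ext p
  simp

theorem isSemilinearSet_setOfPred_iterate_eq {Q : Type*} [Finite Q] (f : Q → Q) (q q' : Q) :
    IsSemilinearSet {n : ℕ | f^[n] q = q'} := by
  obtain ⟨i, j, hlt, hij⟩ : ∃ i j, i < j ∧ f^[i] q = f^[j] q := by
    simpa using! Set.finite_univ.exists_lt_map_eq_of_forall_mem (f := fun n : ℕ => f^[n] q)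
  rw [Nat.isSemilinearSet_iff_ultimately_periodic]
  refine ⟨i, j - i, Nat.sub_pos_of_lt hlt, fun n hn => ?_⟩
  obtain ⟨t, rfl⟩ := Nat.exists_eq_add_of_le' hn
  have hshift : t + i + (j - i) = t + j := by omega
  simp only [Set.mem_ofPred_eq, hshift, Function.iterate_add_apply, hij]

/-- The composition of two relations `R ⊆ X × Y` and `S ⊆ Y × Z` whose pairs carry labels, the
label of a composite pair being the pair of labels. The label is placed in the middle. -/
def labelComp (R : Set (X × M × Y)) (S : Set (Y × N × Z)) :
    Set (X × (M × N) × Z) :=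
  {p | ∃ y, (p.1, p.2.1.1, y) ∈ R ∧ (y, p.2.1.2, p.2.2) ∈ S}

theorem isSemilinearSet_labelComp [AddMonoid.FG M] [AddMonoid.FG N] [AddMonoid.FG X]
    [AddMonoid.FG Y] [AddMonoid.FG Z] {R : Set (X × M × Y)} {S : Set (Y × N × Z)}
    (hR : IsSemilinearSet R) (hS : IsSemilinearSet S) : IsSemilinearSet (labelComp R S) := by
  let composite := AddMonoidHom.fst (X × (M × N) × Z) Y
  let middle := AddMonoidHom.snd (X × (M × N) × Z) Y
  let source := (AddMonoidHom.fst _ _).comp composite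
  let labels := (AddMonoidHom.fst _ _).comp ((AddMonoidHom.snd _ _).comp composite)
  let target := (AddMonoidHom.snd _ _).comp ((AddMonoidHom.snd _ _).comp composite)
  exact isSemilinearSet_setOfPred_exists <|
    (hR.preimage (source.prod (((AddMonoidHom.fst _ _).comp labels).prod middle))).inter
      (hS.preimage (middle.prod (((AddMonoidHom.snd _ _).comp labels).prod target)))

end Semilinear

section SkewProduct

variable {Q C X : Type*}

/-- The graph of the iterates of `f`, as a relation labelled with the number of iterations. -/
def iterateGraph (f : X → X) : Set (X × ℕ × X) :=
  {p | f^[p.2.1] p.1 = p.2.2}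

/-- The skew product of the map `f` with the finite automaton `δ`: the automaton reads the colors
of the points along the orbit of `f`. -/
def skewProduct (δ : Q → C → Q) (c : X → C) (f : X → X) (p : Q × X) : Q × X :=
  (δ p.1 (c p.2), f p.2)

variable (δ : Q → C → Q) (c : X → C) (f : X → X)

/-- The relation between the points before and after `n` steps of the skew product that lead from
state `q` to state `q'`, labelled with `n`. -/
def skewTransition (q q' : Q) : Set (X × ℕ × X) :=
  {p | (skewProduct δ c f)^[p.2.1] (q, p.1) = (q', p.2.2)}

/-- The part of `skewTransition` in which the automaton reads one and the same color throughout. -/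
def monochromaticTransition (q q' : Q) : Set (X × ℕ × X) :=
  {p ∈ skewTransition δ c f q q' | ∀ i < p.2.1, c (f^[i] p.1) = c p.1}

/-- The transitions of the skew product that are composed of at most `k + 1` monochromatic ones. -/
def phaseTransition : ℕ → Q → Q → Set (X × ℕ × X)
  | 0, q, q' => monochromaticTransition δ c f q q'
  | k + 1, q, q' => monochromaticTransition δ c f q q' ∪
      Prod.map id (Prod.map (fun n => n.1 + n.2) id) ''
        ⋃ e, labelComp (monochromaticTransition δ c f q e) (phaseTransition k e q')

variable {δ c f}

theorem skewProduct_iterate_snd (n : ℕ) (p : Q × X) :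
    ((skewProduct δ c f)^[n] p).2 = f^[n] p.2 :=
  (Function.Semiconj.iterate_right (f := Prod.snd) (fun _ => rfl) n) p

theorem skewProduct_iterate_of_color_eq {k : C} {n : ℕ} {x : X} (q : Q)
    (hx : ∀ i < n, c (f^[i] x) = k) :
    (skewProduct δ c f)^[n] (q, x) = ((δ · k)^[n] q, f^[n] x) := by
  induction n with
  | zero => rfl
  | succ n ih =>
    rw [Function.iterate_succ_apply', ih fun i hi => hx i (by lia), skewProduct,
      hx n n.lt_succ_self, Function.iterate_succ_apply', Function.iterate_succ_apply']

theorem mem_monochromaticTransition_iff {q q' : Q} {p : X × ℕ × X} :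
    p ∈ monochromaticTransition δ c f q q' ↔
      ∃ k, (δ · k)^[p.2.1] q = q' ∧ p ∈ iterateGraph f ∧ ∀ i < p.2.1, c (f^[i] p.1) = k := by
  obtain ⟨x, n, y⟩ := p
  constructor
  · rintro ⟨hstep, hcolor⟩
    rw [skewTransition, Set.mem_ofPred_eq, skewProduct_iterate_of_color_eq q hcolor] at hstep
    exact ⟨c x, congrArg Prod.fst hstep, congrArg Prod.snd hstep, hcolor⟩
  · rintro ⟨k, hstate, hpoint, hcolor⟩
    refine ⟨?_, fun i hi => (hcolor i hi).trans (hcolor 0 (by lia)).symm⟩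
    exact (skewProduct_iterate_of_color_eq q hcolor).trans (Prod.ext hstate hpoint)

theorem phaseTransition_subset_skewTransition (k : ℕ) (q q' : Q) :
    phaseTransition δ c f k q q' ⊆ skewTransition δ c f q q' := by
  induction k generalizing q with
  | zero => exact Set.sep_subset _ _
  | succ k ih =>
    rintro p (hp | ⟨⟨x, ⟨m, n⟩, z⟩, hcomp, rfl⟩)
    · exact hp.1
    · obtain ⟨e, y, hfirst, hrest⟩ := Set.mem_iUnion.1 hcomp
      change (skewProduct δ c f)^[m + n] (q, x) = (q', z)
      rw [add_comm, Function.iterate_add_apply, show _ = (e, y) from hfirst.1]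
      exact ih e hrest

theorem monochromaticTransition_subset_phaseTransition (k : ℕ) (q q' : Q) :
    monochromaticTransition δ c f q q' ⊆ phaseTransition δ c f k q q' := by
  cases k with
  | zero => exact subset_rfl
  | succ k => exact Set.subset_union_left

theorem exists_first_color_change {n : ℕ} {x : X} (hx : ¬ ∀ i < n, c (f^[i] x) = c x) :
    ∃ i m, n = i + m ∧ (∀ j < i, c (f^[j] x) = c x) ∧ c (f^[i] x) ≠ c x := by
  classical
  obtain ⟨i, hin, hi⟩ : ∃ i < n, c (f^[i] x) ≠ c x := by simpa using hx
  have hne : ∃ j, c (f^[j] x) ≠ c x := ⟨i, hi⟩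
  obtain ⟨m, hm⟩ := Nat.exists_eq_add_of_le ((Nat.find_min' hne hi).trans hin.le)
  exact ⟨Nat.find hne, m, hm, fun j hj => not_not.1 (Nat.find_min hne hj), Nat.find_spec hne⟩

section Rank

variable {r : X → ℕ} (hr_le : ∀ x, r (f x) ≤ r x) (hr_lt : ∀ x, c (f x) ≠ c x → r (f x) < r x)

include hr_le hr_lt

theorem rank_iterate_lt_of_color_ne {n : ℕ} {x : X} (hne : c (f^[n] x) ≠ c x) :
    r (f^[n] x) < r x := by
  have hanti : Antitone fun n => r (f^[n] x) :=
    antitone_nat_of_succ_le fun n => by simpa only [Function.iterate_succ_apply'] using hr_le _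
  induction n with
  | zero => exact absurd rfl hne
  | succ n ih =>
    by_cases hn : c (f^[n] x) = c x
    · rw [Function.iterate_succ_apply'] at hne ⊢
      exact (hr_lt _ (hn ▸ hne)).trans_le (hanti n.zero_le)
    · exact (hanti n.le_succ).trans_lt (ih hn)

/-- The first change of color ends a monochromatic phase, after which the rank has dropped. -/
theorem mem_phaseTransition_of_rank_le {k : ℕ} {q q' : Q} {p : X × ℕ × X}
    (hp : p ∈ skewTransition δ c f q q') (hk : r p.1 ≤ k) :
    p ∈ phaseTransition δ c f k q q' := by
  obtain ⟨x, n, z⟩ := p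
  induction k generalizing q x n with
  | zero =>
    refine ⟨hp, fun i _ => of_not_not fun hne => ?_⟩
    exact absurd (rank_iterate_lt_of_color_ne hr_le hr_lt hne) (by simp_all)
  | succ k ih =>
    by_cases hmono : ∀ i < n, c (f^[i] x) = c x
    · exact monochromaticTransition_subset_phaseTransition _ _ _ ⟨hp, hmono⟩
    · obtain ⟨m, n, rfl, hsame, hne⟩ := exists_first_color_change hmono
      let mid := (skewProduct δ c f)^[m] (q, x)
      have hmid : mid.2 = f^[m] x := skewProduct_iterate_snd m (q, x)
      have hrest : (mid.2, n, z) ∈ phaseTransition δ c f k mid.1 q' := by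
        refine ih mid.2 n ?_ ?_
        · rwa [skewTransition, Set.mem_ofPred_eq, add_comm, Function.iterate_add_apply] at hp
        · rw [hmid]
          exact Nat.le_of_lt_succ ((rank_iterate_lt_of_color_ne hr_le hr_lt hne).trans_le hk)
      exact .inr ⟨(x, (m, n), z), Set.mem_iUnion.2 ⟨mid.1, mid.2, ⟨rfl, hsame⟩, hrest⟩, rfl⟩

end Rank

theorem isSemilinearSet_monochromaticTransition [Finite Q] [Finite C] [AddCommMonoid X]
    [AddMonoid.FG X] (hf : IsSemilinearSet (iterateGraph f))
    (hc : ∀ k, IsSemilinearSet (c ⁻¹' {k})) (q q' : Q) :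
    IsSemilinearSet (monochromaticTransition δ c f q q') := by
  have hcolor (k : C) : IsSemilinearSet {p : X × ℕ | c (f^[p.2] p.1) = k} := by
    have himage := (hf.inter ((hc k).preimage ((AddMonoidHom.snd ℕ X).comp (.snd X _)))).image
      ((AddMonoidHom.id X).prodMap (.fst ℕ X))
    convert! himage using 1
    ext ⟨x, n⟩
    simp [iterateGraph]
  have hphase (k : C) := (((isSemilinearSet_setOfPred_iterate_eq (δ · k) q q').preimage
      ((AddMonoidHom.fst ℕ X).comp (.snd X _))).inter hf).inter
    ((isSemilinearSet_setOfPred_forall_lt (hcolor k)).preimage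
      ((AddMonoidHom.id X).prodMap (.fst ℕ X)))
  convert! IsSemilinearSet.iUnion hphase using 1
  ext p
  simp [mem_monochromaticTransition_iff, and_assoc]

theorem isSemilinearSet_phaseTransition [Finite Q] [Finite C] [AddCommMonoid X]
    [AddMonoid.FG X] (hf : IsSemilinearSet (iterateGraph f))
    (hc : ∀ k, IsSemilinearSet (c ⁻¹' {k})) (k : ℕ) (q q' : Q) :
    IsSemilinearSet (phaseTransition δ c f k q q') := by
  have hmono := isSemilinearSet_monochromaticTransition (δ := δ) hf hc
  induction k generalizing q with
  | zero => exact hmono q q'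
  | succ k ih =>
    let addLabels := (AddMonoidHom.id X).prodMap
      (((AddMonoidHom.id ℕ).coprod (.id ℕ)).prodMap (.id X))
    exact (hmono q q').union <|
      (IsSemilinearSet.iUnion fun e => isSemilinearSet_labelComp (hmono q e) (ih e)).image addLabels

theorem isSemilinearSet_skewTransition [Finite Q] [Finite C] [AddCommMonoid X] [AddMonoid.FG X]
    {r : X → ℕ} {b : ℕ} (hf : IsSemilinearSet (iterateGraph f))
    (hc : ∀ k, IsSemilinearSet (c ⁻¹' {k})) (hr_le : ∀ x, r (f x) ≤ r x)
    (hr_lt : ∀ x, c (f x) ≠ c x → r (f x) < r x) (hr_bdd : ∀ x, r x ≤ b) (q q' : Q) :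
    IsSemilinearSet (skewTransition δ c f q q') := by
  convert! isSemilinearSet_phaseTransition hf hc b q q' using 1
  exact Set.Subset.antisymm
    (fun p hp => mem_phaseTransition_of_rank_le hr_le hr_lt hp (hr_bdd p.1))
    (phaseTransition_subset_skewTransition b q q')

theorem isSemilinearSet_iterateGraph_piMap {ι : Type*} [Finite ι] [AddCommMonoid X]
    [AddMonoid.FG X] {g : ι → X → X} (hg : ∀ i, IsSemilinearSet (iterateGraph (g i))) :
    IsSemilinearSet (iterateGraph (Pi.map g)) := by
  let coord (i : ι) : (ι → X) × ℕ × (ι → X) →+ X × ℕ × X :=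
    (Pi.evalAddMonoidHom _ i).prodMap ((AddMonoidHom.id ℕ).prodMap (Pi.evalAddMonoidHom _ i))
  convert! IsSemilinearSet.iInter fun i => (hg i).preimage (coord i) using 1
  ext p
  simp [iterateGraph, coord, funext_iff]

end SkewProduct

namespace CounterOp

/-- How often the value still becomes or ceases to be zero when the operation is repeated
forever. -/
def rank : CounterOp → ℤ → ℕ
  | inc, x => if x < 0 then 2 else if x = 0 then 1 else 0
  | dec, x => if 0 < x then 2 else if x = 0 then 1 else 0
  | reset, x => if x = 0 then 0 else 1
  | nop, _ => 0

theorem rank_le_two (o : CounterOp) (x : ℤ) : o.rank x ≤ 2 := by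
  cases o <;> grind [rank]

theorem rank_apply_le (o : CounterOp) (x : ℤ) : o.rank (o.apply x) ≤ o.rank x := by
  cases o <;> grind [rank, apply]

theorem rank_apply_lt {o : CounterOp} {x : ℤ} (h : ¬(o.apply x = 0 ↔ x = 0)) :
    o.rank (o.apply x) < o.rank x := by
  cases o <;> grind [rank, apply]

theorem iterate_inc (n : ℕ) (x : ℤ) : inc.apply^[n] x = x + n :=
  (add_right_iterate_apply (n := n) (1 : ℤ) x).trans (by rw [nsmul_one])

theorem iterate_dec (n : ℕ) (x : ℤ) : dec.apply^[n] x = x - n :=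
  (add_right_iterate_apply (n := n) (-1 : ℤ) x).trans (by simp [sub_eq_add_neg])

theorem iterate_nop (n : ℕ) (x : ℤ) : nop.apply^[n] x = x :=
  Function.iterate_fixed rfl n

theorem iterate_reset (n : ℕ) (x : ℤ) : reset.apply^[n] x = if n = 0 then x else 0 := by
  cases n with
  | zero => rfl
  | succ n => rw [Function.iterate_succ_apply', if_neg n.succ_ne_zero, apply]

theorem isSemilinearSet_iterateGraph_apply (o : CounterOp) :
    IsSemilinearSet (iterateGraph o.apply) := by
  let source : ℤ × ℕ × ℤ →+ ℤ := AddMonoidHom.fst _ _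
  let target : ℤ × ℕ × ℤ →+ ℤ := (AddMonoidHom.snd _ _).comp (AddMonoidHom.snd _ _)
  let count : ℤ × ℕ × ℤ →+ ℕ := (AddMonoidHom.fst _ _).comp (AddMonoidHom.snd _ _)
  let countZ : ℤ × ℕ × ℤ →+ ℤ := (Nat.castAddMonoidHom ℤ).comp count
  have hfixed := isSemilinearSet_setOfPred_eq 0 0 source target
  cases o with
  | inc =>
    convert! isSemilinearSet_setOfPred_eq 0 0 (source + countZ) target using 1
    ext p
    simp [iterateGraph, iterate_inc, source, target, countZ, count]
  | dec =>
    convert! isSemilinearSet_setOfPred_eq 0 0 source (target + countZ) using 1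
    ext p
    simp [iterateGraph, iterate_dec, source, target, countZ, count, sub_eq_iff_eq_add]
  | nop =>
    convert! hfixed using 1
    ext p
    simp [iterateGraph, iterate_nop, source, target]
  | reset =>
    have hzero := (IsSemilinearSet.singleton 0).preimage count
    have hreset := (IsSemilinearSet.singleton 0).preimage target
    convert! (hzero.inter hfixed).union (hzero.compl.inter hreset) using 1
    ext p
    by_cases hp : p.2.1 = 0 <;>
      simp [iterateGraph, iterate_reset, source, target, count, hp, eq_comm]

end CounterOp

section CounterVector

variable {d : ℕ} (u : Fin d → CounterOp)

/-- The total rank of the counters under simultaneous repetition of the operations `u`: it bounds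
the number of changes of the mask. -/
def counterRank (x : Fin d → ℤ) : ℕ :=
  ∑ i, (u i).rank (x i)

theorem counterRank_le (x : Fin d → ℤ) : counterRank u x ≤ d * 2 := by
  simpa [counterRank] using
    Finset.sum_le_card_nsmul Finset.univ _ 2 fun i _ => (u i).rank_le_two (x i)

theorem counterRank_apply_le (x : Fin d → ℤ) :
    counterRank u (Pi.map (fun i => (u i).apply) x) ≤ counterRank u x :=
  Finset.sum_le_sum fun i _ => (u i).rank_apply_le (x i)

theorem counterRank_apply_lt {x : Fin d → ℤ}
    (hx : counterMask (Pi.map (fun i => (u i).apply) x) ≠ counterMask x) :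
    counterRank u (Pi.map (fun i => (u i).apply) x) < counterRank u x := by
  obtain ⟨i, hi⟩ := Function.ne_iff.1 hx
  have hlt : (u i).rank ((u i).apply (x i)) < (u i).rank (x i) :=
    CounterOp.rank_apply_lt fun h => hi (by simp [counterMask, h])
  exact Finset.sum_lt_sum (fun i _ => (u i).rank_apply_le (x i)) ⟨i, Finset.mem_univ i, hlt⟩

theorem isSemilinearSet_counterMask_preimage (m : Fin d → Bool) :
    IsSemilinearSet (counterMask ⁻¹' {m}) := by
  have hcoord (b : Bool) : IsSemilinearSet {t : ℤ | decide (t ≠ 0) = b} := by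
    have hzero := IsSemilinearSet.singleton (0 : ℤ)
    cases b with
    | false => convert! hzero; ext; simp
    | true => convert! hzero.compl; ext; simp
  convert! IsSemilinearSet.iInter fun i =>
    (hcoord (m i)).preimage (Pi.evalAddMonoidHom (fun _ => ℤ) i) using 1
  ext x
  simp [counterMask, funext_iff]

theorem isSemilinearSet_skewTransition_counterMask {Q : Type*} [Finite Q]
    (δ : Q → (Fin d → Bool) → Q) (q q' : Q) :
    IsSemilinearSet (skewTransition δ counterMask (Pi.map fun i => (u i).apply) q q') :=
  isSemilinearSet_skewTransition
    (isSemilinearSet_iterateGraph_piMap fun i => (u i).isSemilinearSet_iterateGraph_apply)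
    isSemilinearSet_counterMask_preimage (counterRank_apply_le u)
    (fun _ => counterRank_apply_lt u) (counterRank_le u) q q'

end CounterVector

section BlockWord

variable {α : Type*}

/-- The word whose blocks of equal letters follow the list `l`, the block of the letter `a` having
length `v a`. If `l` lists every letter once, this is the sorted word with Parikh vector `v`. -/
def blockWord (l : List α) (v : α → ℕ) : List α :=
  l.flatMap fun a => List.replicate (v a) a

theorem parikh_blockWord_toList [Fintype α] [DecidableEq α] (v : α → ℕ) :
    parikh (blockWord Finset.univ.toList v) = v := by
  ext a
  simp [parikh, blockWord, List.count_flatMap, Function.comp_def, List.count_replicate,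
    Finset.sum_map_toList]

theorem PermutationInvariant.setOfPred_parikh_eq [Fintype α] [DecidableEq α] {L : Language α}
    (hL : PermutationInvariant L) :
    {v | ∃ w, w ∈ L ∧ parikh w = v} = {v | blockWord Finset.univ.toList v ∈ L} := by
  ext v
  constructor
  · rintro ⟨w, hw, rfl⟩
    exact (hL w _ (parikh_blockWord_toList (parikh w)).symm).1 hw
  · exact fun hv => ⟨_, hv, parikh_blockWord_toList v⟩

end BlockWord

namespace SimplifiedMulticounterMachine

variable {Q α : Type*} {d : ℕ} (M : SimplifiedMulticounterMachine Q α d)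

/-- The configuration that follows `c` when `a` is read. -/
def next (a : α) : Q × (Fin d → ℤ) → Q × (Fin d → ℤ) :=
  skewProduct (fun q => M.trans q a) counterMask (Pi.map fun i => (M.update a i).apply)

/-- The configuration reached from `c` by reading the word `w`. -/
def exec (w : List α) (c : Q × (Fin d → ℤ)) : Q × (Fin d → ℤ) :=
  w.foldl (fun c a => M.next a c) c

theorem step_iff {a : α} {c c' : Q × (Fin d → ℤ)} : M.Step a c c' ↔ c' = M.next a c := by
  rw [Prod.ext_iff, funext_iff]
  rfl

theorem run_iff {w : List α} {c c' : Q × (Fin d → ℤ)} : M.Run w c c' ↔ M.exec w c = c' := by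
  induction w generalizing c with
  | nil =>
    constructor
    · rintro ⟨⟩
      rfl
    · rintro rfl
      exact .nil _
  | cons a w ih =>
    constructor
    · rintro (_ | ⟨hstep, hrun⟩)
      obtain rfl := M.step_iff.1 hstep
      exact ih.1 hrun
    · exact fun h => .cons (M.step_iff.2 rfl) (ih.2 h)

theorem mem_acceptedLanguage_iff {w : List α} :
    w ∈ M.acceptedLanguage ↔
      ((M.exec w (M.start, 0)).1, counterMask (M.exec w (M.start, 0)).2) ∈ M.accept := by
  constructor
  · rintro ⟨q, x, hrun, hmem⟩
    rwa [show M.exec w (M.start, 0) = (q, x) from M.run_iff.1 hrun]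
  · exact fun hmem => ⟨_, _, M.run_iff.2 rfl, hmem⟩

theorem exec_replicate (n : ℕ) (a : α) (c : Q × (Fin d → ℤ)) :
    M.exec (List.replicate n a) c = (M.next a)^[n] c := by
  induction n generalizing c with
  | zero => rfl
  | succ _ ih => exact ih (M.next a c)

theorem exec_blockWord_cons (a : α) (l : List α) (v : α → ℕ) (c : Q × (Fin d → ℤ)) :
    M.exec (blockWord (a :: l) v) c = M.exec (blockWord l v) ((M.next a)^[v a] c) := by
  rw [← exec_replicate]
  exact List.foldl_append

/-- The relation between the counter values before and after those runs on words `blockWord l v`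
that lead from state `q` to state `q'`, labelled with `v`. -/
def blockTransition (l : List α) (q q' : Q) : Set ((Fin d → ℤ) × (α → ℕ) × (Fin d → ℤ)) :=
  {p | M.exec (blockWord l p.2.1) (q, p.1) = (q', p.2.2)}

theorem mem_blockTransition_cons_iff {a : α} {l : List α} {q q' : Q} {x y : Fin d → ℤ}
    {v : α → ℕ} :
    (x, v, y) ∈ M.blockTransition (a :: l) q q' ↔
      ∃ e, (x, (v a, v), y) ∈ labelComp
        (skewTransition (M.trans · a) counterMask (Pi.map fun i => (M.update a i).apply) q e)
        (M.blockTransition l e q') := by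
  rw [blockTransition, Set.mem_ofPred_eq, exec_blockWord_cons]
  constructor
  · exact fun h => ⟨((M.next a)^[v a] (q, x)).1, ((M.next a)^[v a] (q, x)).2, rfl, h⟩
  · rintro ⟨e, z, hfirst, hrest⟩
    rwa [show (M.next a)^[v a] (q, x) = (e, z) from hfirst]

theorem isSemilinearSet_blockTransition [Finite Q] [Finite α] (l : List α) (q q' : Q) :
    IsSemilinearSet (M.blockTransition l q q') := by
  induction l generalizing q with
  | nil =>
    by_cases hq : q = q'
    · convert! isSemilinearSet_setOfPred_eq 0 0 (AddMonoidHom.fst (Fin d → ℤ) _)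
        ((AddMonoidHom.snd (α → ℕ) _).comp (.snd (Fin d → ℤ) _)) using 1
      ext p
      simp [blockTransition, blockWord, exec, hq]
    · convert! IsSemilinearSet.empty
      ext p
      simp [blockTransition, blockWord, exec, hq]
  | cons a l ih =>
    let splitLabel := (AddMonoidHom.id (Fin d → ℤ)).prodMap
      (((Pi.evalAddMonoidHom (fun _ : α => ℕ) a).prod (.id _)).prodMap (.id (Fin d → ℤ)))
    convert! IsSemilinearSet.iUnion fun e => (isSemilinearSet_labelComp
      (isSemilinearSet_skewTransition_counterMask (M.update a) (M.trans · a) q e)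
      (ih e)).preimage splitLabel using 1
    ext ⟨x, v, y⟩
    rw [Set.mem_iUnion]
    exact M.mem_blockTransition_cons_iff

theorem isSemilinearSet_setOfPred_blockWord_mem [Finite Q] [Finite α] (l : List α) :
    IsSemilinearSet {v | blockWord l v ∈ M.acceptedLanguage} := by
  let source := AddMonoidHom.fst (Fin d → ℤ) ((α → ℕ) × (Fin d → ℤ))
  let label := (AddMonoidHom.fst (α → ℕ) (Fin d → ℤ)).comp (.snd (Fin d → ℤ) _)
  let target := (AddMonoidHom.snd (α → ℕ) (Fin d → ℤ)).comp (.snd (Fin d → ℤ) _)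
  have haccept (e : M.accept) :=
    ((M.isSemilinearSet_blockTransition l M.start e.1.1).inter
      (((IsSemilinearSet.singleton 0).preimage source).inter
        ((isSemilinearSet_counterMask_preimage e.1.2).preimage target))).image label
  convert! IsSemilinearSet.iUnion haccept using 1
  ext v
  rw [Set.mem_iUnion, Set.mem_ofPred_eq, mem_acceptedLanguage_iff]
  constructor
  · exact fun hv => ⟨⟨_, hv⟩, (0, v, (M.exec (blockWord l v) (M.start, 0)).2), ⟨rfl, rfl, rfl⟩, rfl⟩
  · rintro ⟨⟨⟨q, m⟩, hmem⟩, ⟨x, v, y⟩, ⟨hrun, rfl, rfl⟩, rfl⟩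
    have hexec : M.exec (blockWord l v) (M.start, 0) = (q, y) := hrun
    change ((M.exec (blockWord l v) (M.start, 0)).1,
      counterMask (M.exec (blockWord l v) (M.start, 0)).2) ∈ M.accept
    rwa [hexec]

end SimplifiedMulticounterMachine

theorem mainTheorem11 {α : Type*} [Finite α] [DecidableEq α] (L : Language α)
    (hperm : PermutationInvariant L)
    {Q : Type*} [Finite Q] {d : ℕ} (M : SimplifiedMulticounterMachine Q α d)
    (hacc : M.acceptedLanguage = L) :
    IsSemilinearSet {v : α → ℕ | ∃ w : List α, w ∈ L ∧ parikh w = v} := by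
  have : Fintype α := Fintype.ofFinite α
  subst hacc
  rw [hperm.setOfPred_parikh_eq]
  exact M.isSemilinearSet_setOfPred_blockWord_mem _
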